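/- Let $k$ be any field, let $m\ge 4$ be an integer not divisible by $\operatorname{char}k$ (automatic if $\operatorname{char}k=0$), and put $n=2m+1$. Let $A=k[s,x,y]$, $\mathfrak m=(s,x,y)$, $g=xy(x-y)(x+y-sy)$, $\mathfrak e=(x^n,y^n,g)$, $f=\sum_{j=2}^{n-1}(-1)^jx^{n+1-j}y^j$ and $\mathfrak h=\mathfrak e+(f)$. For ideals $I,J$ of $A$ write $I:J^\infty=\bigcup_{N\ge0}(I:J^N)$, and write $I:s^\infty$ for $I:(s)^\infty$. Then: 1. $(x,y)^{n+2}\subseteq\mathfrak e$; 2. $sf\in\mathfrak e$, and hence $\mathfrak h\subseteq(\mathfrak e:s)$; 3. $xf\in\mathfrak e$ and $yf\in\mathfrak e$, and hence $\mathfrak m\subseteq(\mathfrak e:f)$; 4. $f\notin\mathfrak e$, and hence $(\mathfrak e:f)\ne A$ and $(\mathfrak e:f)=\mathfrak m$; 5. $\mathfrak h$ is $s$-saturated, that is, $(\mathfrak h:s)=\mathfrak h$; 6. $\mathfrak e:\mathfrak m^\infty=\mathfrak e:s^\infty=\mathfrak h$; 7. $H^0_{\mathfrak m}(A/\mathfrak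 e)\cong A/\mathfrak m$ as $A$-modules, where $H^0_{\mathfrak m}$ denotes local cohomology with support in $\mathfrak m$. -/

import Mathlib

universe u

noncomputable section

namespace ConsExample

/-- The saturation `I : J^∞ = ⋃ N, (I : J ^ N)` of an ideal `I` with respect to an ideal `J`. -/
def saturation {R : Type u} [CommRing R] (I J : Ideal R) : Ideal R where
  carrier := {a | ∃ N : ℕ, ∀ b ∈ J ^ N, a * b ∈ I}
  zero_mem' := ⟨0, fun b _ => by simp⟩
  add_mem' := by
    rintro a a' ⟨N, hN⟩ ⟨N', hN'⟩
    refine ⟨max N N', fun b hb => ?_⟩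
    rw [add_mul]
    exact I.add_mem (hN b (Ideal.pow_le_pow_right (le_max_left N N') hb))
      (hN' b (Ideal.pow_le_pow_right (le_max_right N N') hb))
  smul_mem' := by
    rintro c a ⟨N, hN⟩
    refine ⟨N, fun b hb => ?_⟩
    rw [smul_eq_mul, mul_assoc]
    exact I.mul_mem_left c (hN b hb)

variable (k : Type u) [Field k]

/-- The polynomial ring `k[s, x, y]`, with `s`, `x`, `y` the variables `0`, `1`, `2`. -/
abbrev A : Type u := MvPolynomial (Fin 3) k

/-- The variable `s`. -/
def s : A k := MvPolynomial.X 0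

/-- The variable `x`. -/
def x : A k := MvPolynomial.X 1

/-- The variable `y`. -/
def y : A k := MvPolynomial.X 2

/-- The homogeneous maximal ideal `(s, x, y)`. -/
def maxIdeal : Ideal (A k) := Ideal.span {s k, x k, y k}

/-- `g = x y (x - y) (x + y - s y)`. -/
def g : A k := x k * y k * (x k - y k) * (x k + y k - s k * y k)

/-- The ideal `e = (x ^ n, y ^ n, g)`. -/
def e (n : ℕ) : Ideal (A k) := Ideal.span {x k ^ n, y k ^ n, g k}

/-- `f = ∑_{j = 2}^{n - 1} (-1) ^ j x ^ (n + 1 - j) y ^ j`. -/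
def f (n : ℕ) : A k := ∑ j ∈ Finset.Icc 2 (n - 1), (-1) ^ j * x k ^ (n + 1 - j) * y k ^ j

/-- The ideal `h = e + (f)`. -/
def h (n : ℕ) : Ideal (A k) := e k n ⊔ Ideal.span {f k n}

end ConsExample

end

open CategoryTheory ConsExample

open CategoryTheory ConsExample
namespace ConsExample

/-! ### Identities and ideal membership over a commutative ring. -/

section Ring
variable {R : Type*} [CommRing R]

/-! Write S for the geometric sum with (x² - y²)S = x^(2m) - y^(2m). Then f = xy(x^(2m) - x(x -
y)S), which gives sf = xⁿy - (1 - s)xyⁿ - Sg (`s_mul_f`), so sf ∈ e. Modulo g, x³y is a combination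
of x²y² and xy³, so mixed monomials of degree n + 2 lie in the smaller ideal `mixedIdeal`; it
contains xf and yf.

The core is that h is s-saturated (`mem_h_of_s_mul_mem_h`). If sp ∈ h, setting s = 0 gives a syzygy
of xⁿ, yⁿ, xy(x - y)(x + y), f. Its first two coefficients are yu' and xv', and the constant terms
of u' + v' and of the coefficient of f vanish (`constantCoeff_of_syzygy`); here m must be nonzero in
k. Subtracting some q ∈ h from p leaves s(p - q) ∈ `mixedIdeal`, where s can be cancelled at the
cost of landing in e. The same syzygy lemma shows f ∉ e.

The saturations then follow from e : 𝔪^∞ ⊆ e : s^∞ ⊆ h ⊆ e : 𝔪^∞. The 𝔪-power torsion of A/e is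
therefore h/e, generated by the class of f with annihilator 𝔪, and it computes H⁰ through colim
Hom(A/𝔪^t, A/e). -/

/-- The geometric sum `∑_{i < m} x ^ (2 (m - 1 - i)) y ^ (2 i)`, defined recursively. -/
def evenGeomSum (a b : R) : ℕ → R
  | 0 => 0
  | m + 1 => a ^ 2 * evenGeomSum a b m + b ^ (2 * m)

lemma evenGeomSum_mul (a b : R) (m : ℕ) :
    (a - b) * (a + b) * evenGeomSum a b m = a ^ (2 * m) - b ^ (2 * m) := by
  induction m with
  | zero => simp [evenGeomSum]
  | succ m ih =>
    rw [evenGeomSum, mul_add, show (a - b) * (a + b) * (a ^ 2 * evenGeomSum a b m) =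
      a ^ 2 * ((a - b) * (a + b) * evenGeomSum a b m) by ring, ih]
    ring

/-- Only even powers occur, so at (-b, b) all m terms coincide. This is where the factor m, hence
the characteristic, enters; the factor `b ^ 2` avoids the exponent 2m - 2. -/
lemma evenGeomSum_neg (b : R) (m : ℕ) :
    b ^ 2 * evenGeomSum (-b) b m = m * b ^ (2 * m) := by
  induction m with
  | zero => simp [evenGeomSum]
  | succ m ih =>
    rw [evenGeomSum, mul_add, neg_sq, ih]
    push_cast
    ring

lemma map_evenGeomSum {S : Type*} [CommRing S] (φ : R →+* S) (a b : R) (m : ℕ) :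
    φ (evenGeomSum a b m) = evenGeomSum (φ a) (φ b) m := by
  induction m with
  | zero => simp [evenGeomSum]
  | succ m ih => simp [evenGeomSum, ih]

lemma alternating_sum_eq (a b : R) (m : ℕ) :
    ∑ j ∈ Finset.Icc 2 (2 * (m + 1)), (-1) ^ j * a ^ (2 * (m + 1) + 2 - j) * b ^ j =
      a * b * (a ^ (2 * (m + 1)) - a * (a - b) * evenGeomSum a b (m + 1)) := by
  induction m with
  | zero => simp [evenGeomSum]; ring
  | succ m ih =>
    rw [show 2 * (m + 1 + 1) = 2 * (m + 1) + 1 + 1 by ring, Finset.sum_Icc_succ_top (by omega),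
      Finset.sum_Icc_succ_top (by omega)]
    have : ∑ j ∈ Finset.Icc 2 (2 * (m + 1)),
        (-1) ^ j * a ^ (2 * (m + 1) + 1 + 1 + 2 - j) * b ^ j =
        a ^ 2 * ∑ j ∈ Finset.Icc 2 (2 * (m + 1)),
          (-1) ^ j * a ^ (2 * (m + 1) + 2 - j) * b ^ j := by
      rw [Finset.mul_sum]
      refine Finset.sum_congr rfl fun j hj => ?_
      rw [Finset.mem_Icc] at hj
      rw [show 2 * (m + 1) + 1 + 1 + 2 - j = 2 + (2 * (m + 1) + 2 - j) by omega, pow_add]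
      ring
    rw [this, ih, show 2 * (m + 1) + 1 + 1 + 2 - (2 * (m + 1) + 1) = 3 by omega,
      show 2 * (m + 1) + 1 + 1 + 2 - (2 * (m + 1) + 1 + 1) = 2 by omega,
      evenGeomSum.eq_2 a b (m + 1)]
    have h1 : (-1 : R) ^ (2 * (m + 1) + 1) = -1 := Odd.neg_one_pow ⟨_, rfl⟩
    rw [pow_succ (-1 : R) (2 * (m + 1) + 1), h1]
    ring

lemma span_pair_pow_le {a b : R} {N : ℕ} {I : Ideal R}
    (hI : ∀ i j, i + j = N → a ^ i * b ^ j ∈ I) : Ideal.span {a, b} ^ N ≤ I := by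
  induction N generalizing I with
  | zero =>
    have := hI 0 0 rfl
    rw [pow_zero, pow_zero, one_mul] at this
    rw [(Ideal.eq_top_iff_one I).2 this]
    exact le_top
  | succ N ih =>
    have ha : Ideal.span {a, b} ^ N ≤ I.colon {a} := ih fun i j hij => by
      rw [Submodule.mem_colon_singleton, smul_eq_mul, mul_right_comm, ← pow_succ]
      exact hI _ _ (by omega)
    have hb : Ideal.span {a, b} ^ N ≤ I.colon {b} := ih fun i j hij => by
      rw [Submodule.mem_colon_singleton, smul_eq_mul, mul_assoc, ← pow_succ]
      exact hI _ _ (by omega)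
    rw [pow_succ, Ideal.mul_le]
    intro r hr c hc
    obtain ⟨p, q, rfl⟩ := Ideal.mem_span_pair.1 hc
    have h1 := Submodule.mem_colon_singleton.1 (ha hr)
    have h2 := Submodule.mem_colon_singleton.1 (hb hr)
    rw [show r * (p * a + q * b) = p * (r • a) + q * (r • b) by simp only [smul_eq_mul]; ring]
    exact add_mem (I.mul_mem_left _ h1) (I.mul_mem_left _ h2)

end Ring

/-! ### Membership in e and h. -/

variable {k : Type u} [Field k]

lemma f_eq {m : ℕ} (hm : m ≠ 0) : f k (2 * m + 1) =
    x k * y k * (x k ^ (2 * m) - x k * (x k - y k) * evenGeomSum (x k) (y k) m) := by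
  obtain ⟨m, rfl⟩ := Nat.exists_eq_succ_of_ne_zero hm
  exact alternating_sum_eq (x k) (y k) m

lemma s_mul_f {m : ℕ} (hm : m ≠ 0) : s k * f k (2 * m + 1) =
    x k ^ (2 * m + 1) * y k - (1 - s k) * x k * y k ^ (2 * m + 1)
      - evenGeomSum (x k) (y k) m * g k := by
  rw [f_eq hm, g]
  linear_combination (x k * y k * (1 - s k)) * evenGeomSum_mul (x k) (y k) m

/-- The ideal `(x ^ 2 y ^ n, x y ^ (n + 1), g)`. -/
noncomputable def mixedIdeal (k : Type u) [Field k] (n : ℕ) : Ideal (A k) :=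
  Ideal.span {x k ^ 2 * y k ^ n, x k * y k ^ (n + 1), g k}

lemma g_mem_mixedIdeal (n : ℕ) : g k ∈ mixedIdeal k n := Ideal.subset_span (by simp)

/-- Since g = xy(x² - sxy - (1 - s)y²), any monomial divisible by x³y can be traded for ones with
lower x-degree, down to the two monomial generators. -/
lemma monomial_mem_mixedIdeal (n i : ℕ) : ∀ j, i + 1 + (j + 1) = n + 2 →
    x k ^ (i + 1) * y k ^ (j + 1) ∈ mixedIdeal k n := by
  induction i using Nat.strong_induction_on with
  | _ i ih =>
    intro j hij
    match i, ih with
    | 0, _ =>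
      obtain rfl : j = n := by omega
      exact Ideal.subset_span (by simp)
    | 1, _ =>
      obtain rfl : n = j + 1 := by omega
      exact Ideal.subset_span (by simp)
    | i + 2, ih =>
      have h1 := ih (i + 1) (by omega) (j + 1) (by omega)
      have h2 := ih i (by omega) (j + 2) (by omega)
      have : x k ^ (i + 2 + 1) * y k ^ (j + 1) = x k ^ i * y k ^ j * g k +
          s k * (x k ^ (i + 1 + 1) * y k ^ (j + 1 + 1)) +
          (1 - s k) * (x k ^ (i + 1) * y k ^ (j + 2 + 1)) := by
        rw [g]; ring
      rw [this]
      exact add_mem (add_mem (Ideal.mul_mem_left _ _ (g_mem_mixedIdeal n))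
        (Ideal.mul_mem_left _ _ h1)) (Ideal.mul_mem_left _ _ h2)

lemma x_pow_mem_e (n : ℕ) : x k ^ n ∈ e k n := Ideal.subset_span (by simp)
lemma y_pow_mem_e (n : ℕ) : y k ^ n ∈ e k n := Ideal.subset_span (by simp)
lemma g_mem_e (n : ℕ) : g k ∈ e k n := Ideal.subset_span (by simp)

lemma mem_e_iff {n : ℕ} {p : A k} :
    p ∈ e k n ↔ ∃ u v w, p = u * x k ^ n + v * y k ^ n + w * g k := by
  simp only [e, Ideal.mem_span_insert, Ideal.mem_span_singleton']
  constructor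
  · rintro ⟨u, _, ⟨v, _, ⟨w, rfl⟩, rfl⟩, rfl⟩
    exact ⟨u, v, w, by ring⟩
  · rintro ⟨u, v, w, rfl⟩
    exact ⟨u, _, ⟨v, _, ⟨w, rfl⟩, rfl⟩, by ring⟩

lemma mem_h_iff {n : ℕ} {p : A k} :
    p ∈ h k n ↔ ∃ u v w t, p = u * x k ^ n + v * y k ^ n + w * g k + t * f k n := by
  simp only [h, Submodule.mem_sup, Ideal.mem_span_singleton', mem_e_iff]
  constructor
  · rintro ⟨_, ⟨u, v, w, rfl⟩, _, ⟨t, rfl⟩, rfl⟩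
    exact ⟨u, v, w, t, rfl⟩
  · rintro ⟨u, v, w, t, rfl⟩
    exact ⟨_, ⟨u, v, w, rfl⟩, _, ⟨t, rfl⟩, rfl⟩

lemma mixedIdeal_le_e (n : ℕ) : mixedIdeal k n ≤ e k n := by
  rw [mixedIdeal, Ideal.span_le]
  rintro _ (rfl | rfl | rfl)
  · exact Ideal.mul_mem_left _ _ (y_pow_mem_e n)
  · rw [pow_succ, ← mul_assoc, mul_right_comm]
    exact Ideal.mul_mem_left _ _ (y_pow_mem_e n)
  · exact g_mem_e n

lemma x_mul_f_mem_mixedIdeal (n : ℕ) : x k * f k n ∈ mixedIdeal k n := by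
  rw [f, Finset.mul_sum]
  refine Ideal.sum_mem _ fun j hj => ?_
  rw [Finset.mem_Icc] at hj
  obtain ⟨j, rfl⟩ := Nat.exists_eq_add_of_le' (show 1 ≤ j by omega)
  have := monomial_mem_mixedIdeal (k := k) n (n + 1 - (j + 1)) j (by omega)
  rw [show x k * ((-1) ^ (j + 1) * x k ^ (n + 1 - (j + 1)) * y k ^ (j + 1)) =
    (-1) ^ (j + 1) * (x k ^ (n + 1 - (j + 1) + 1) * y k ^ (j + 1)) by ring]
  exact Ideal.mul_mem_left _ _ this

lemma y_mul_f_mem_mixedIdeal (n : ℕ) : y k * f k n ∈ mixedIdeal k n := by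
  rw [f, Finset.mul_sum]
  refine Ideal.sum_mem _ fun j hj => ?_
  rw [Finset.mem_Icc] at hj
  obtain ⟨i, hi⟩ := Nat.exists_eq_add_of_le' (show 1 ≤ n + 1 - j by omega)
  have := monomial_mem_mixedIdeal (k := k) n i j (by omega)
  rw [hi, show y k * ((-1) ^ j * x k ^ (i + 1) * y k ^ j) =
    (-1) ^ j * (x k ^ (i + 1) * y k ^ (j + 1)) by ring]
  exact Ideal.mul_mem_left _ _ this

lemma span_xy_pow_le (n : ℕ) : Ideal.span {x k, y k} ^ (n + 2) ≤ e k n := by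
  refine span_pair_pow_le fun i j hij => ?_
  match i, j with
  | 0, j =>
    obtain rfl : j = n + 2 := by omega
    rw [pow_zero, one_mul, pow_add, mul_comm]
    exact Ideal.mul_mem_left _ _ (y_pow_mem_e n)
  | i, 0 =>
    obtain rfl : i = n + 2 := by omega
    rw [pow_zero, mul_one, pow_add, mul_comm]
    exact Ideal.mul_mem_left _ _ (x_pow_mem_e n)
  | i + 1, j + 1 => exact mixedIdeal_le_e n (monomial_mem_mixedIdeal n i j hij)

/-! ### Specialization of variables -/

lemma constantCoeff_x : MvPolynomial.constantCoeff (x k) = 0 := by simp [x]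
lemma constantCoeff_y : MvPolynomial.constantCoeff (y k) = 0 := by simp [y]

lemma sub_aeval_mem {I : Ideal (A k)} (v : Fin 3 → A k)
    (hv : ∀ i, MvPolynomial.X i - v i ∈ I) (p : A k) : p - MvPolynomial.aeval v p ∈ I := by
  rw [← Ideal.Quotient.eq]
  have : (Ideal.Quotient.mkₐ k I) = (Ideal.Quotient.mkₐ k I).comp (MvPolynomial.aeval v) := by
    ext i
    simpa [Ideal.Quotient.eq] using hv i
  exact DFunLike.congr_fun this p

lemma constantCoeff_aeval (v : Fin 3 → A k) (hv : ∀ i, MvPolynomial.constantCoeff (v i) = 0)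
    (p : A k) : MvPolynomial.constantCoeff (MvPolynomial.aeval v p) =
      MvPolynomial.constantCoeff p := by
  induction p using MvPolynomial.induction_on with
  | C a => simp
  | add p q hp hq => rw [map_add, map_add, hp, hq, map_add]
  | mul_X p i hp => simp [hv]

lemma mem_maxIdeal_iff {p : A k} : p ∈ maxIdeal k ↔ MvPolynomial.constantCoeff p = 0 := by
  constructor
  · intro hp
    have : maxIdeal k ≤ RingHom.ker (MvPolynomial.constantCoeff (σ := Fin 3) (R := k)) := by
      rw [maxIdeal, Ideal.span_le]
      rintro _ (rfl | rfl | rfl) <;> simp [s, x, y]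
    exact this hp
  · intro hp
    have := sub_aeval_mem (I := maxIdeal k) 0 (fun i => by
      refine Ideal.subset_span ?_
      fin_cases i <;> simp [s, x, y]) p
    rwa [MvPolynomial.aeval_zero, hp, map_zero, sub_zero] at this

lemma mem_maxIdeal_iff_exists {p : A k} :
    p ∈ maxIdeal k ↔ ∃ a b c, p = a * s k + b * x k + c * y k := by
  simp only [maxIdeal, Ideal.mem_span_insert, Ideal.mem_span_singleton']
  constructor
  · rintro ⟨u, _, ⟨v, _, ⟨w, rfl⟩, rfl⟩, rfl⟩
    exact ⟨u, v, w, by ring⟩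
  · rintro ⟨u, v, w, rfl⟩
    exact ⟨u, _, ⟨v, _, ⟨w, rfl⟩, rfl⟩, by ring⟩

lemma prime_x : Prime (x k) := MvPolynomial.X_prime
lemma prime_y : Prime (y k) := MvPolynomial.X_prime

/-- The endomorphism of `k[s, x, y]` setting `s = 0`. -/
noncomputable def setSZero (k : Type u) [Field k] : A k →ₐ[k] A k :=
  MvPolynomial.aeval ![0, x k, y k]

/-- The endomorphism of `k[s, x, y]` substituting `x = y`. -/
noncomputable def setXEqY (k : Type u) [Field k] : A k →ₐ[k] A k :=
  MvPolynomial.aeval ![s k, y k, y k]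

/-- The endomorphism of `k[s, x, y]` substituting `x = -y`. -/
noncomputable def setXEqNegY (k : Type u) [Field k] : A k →ₐ[k] A k :=
  MvPolynomial.aeval ![s k, -y k, y k]

@[simp] lemma setSZero_s : setSZero k (s k) = 0 := by simp [setSZero, s]
@[simp] lemma setSZero_x : setSZero k (x k) = x k := by simp [setSZero, x]
@[simp] lemma setSZero_y : setSZero k (y k) = y k := by simp [setSZero, y]
@[simp] lemma setXEqY_x : setXEqY k (x k) = y k := by simp [setXEqY, x]
@[simp] lemma setXEqY_y : setXEqY k (y k) = y k := by simp [setXEqY, y]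
@[simp] lemma setXEqNegY_x : setXEqNegY k (x k) = -y k := by simp [setXEqNegY, x]
@[simp] lemma setXEqNegY_y : setXEqNegY k (y k) = y k := by simp [setXEqNegY, y]

@[simp] lemma setSZero_g :
    setSZero k (g k) = x k * y k * (x k - y k) * (x k + y k) := by simp [g]
@[simp] lemma setSZero_f (n : ℕ) : setSZero k (f k n) = f k n := by simp [f]

lemma constantCoeff_setSZero (p : A k) : MvPolynomial.constantCoeff (setSZero k p) =
    MvPolynomial.constantCoeff p :=
  constantCoeff_aeval _ (fun i => by fin_cases i <;> simp [x, y]) p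

lemma constantCoeff_setXEqNegY (p : A k) : MvPolynomial.constantCoeff (setXEqNegY k p) =
    MvPolynomial.constantCoeff p :=
  constantCoeff_aeval _ (fun i => by fin_cases i <;> simp [s, y]) p

lemma exists_eq_setSZero_add (p : A k) : ∃ q, p = setSZero k p + s k * q := by
  have := sub_aeval_mem (I := Ideal.span {s k}) ![0, x k, y k] (fun i => by
      fin_cases i <;> simp [s, x, y]) p
  obtain ⟨q, hq⟩ := Ideal.mem_span_singleton'.1 this
  exact ⟨q, by rw [setSZero]; linear_combination -hq⟩

lemma exists_eq_setXEqY_add (p : A k) : ∃ q, p = setXEqY k p + (x k - y k) * q := by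
  have := sub_aeval_mem (I := Ideal.span {x k - y k}) ![s k, y k, y k] (fun i => by
      fin_cases i <;> simp [s, x, y]) p
  obtain ⟨q, hq⟩ := Ideal.mem_span_singleton'.1 this
  exact ⟨q, by rw [setXEqY]; linear_combination -hq⟩

lemma x_ne_y : x k - y k ≠ 0 := by
  rw [sub_ne_zero, x, y, Ne, MvPolynomial.X_inj]
  decide

lemma not_x_dvd_y : ¬ x k ∣ y k := by
  rw [x, y, MvPolynomial.X_dvd_X]
  decide

lemma not_y_dvd_x : ¬ y k ∣ x k := by
  rw [x, y, MvPolynomial.X_dvd_X]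
  decide

/-! ### Syzygies at s = 0. -/

lemma dvd_of_syzygy {m : ℕ} (hm : m ≠ 0) {u v w t : A k}
    (H : u * x k ^ (2 * m + 1) + v * y k ^ (2 * m + 1) +
      w * (x k * y k * (x k - y k) * (x k + y k)) + t * f k (2 * m + 1) = 0) :
    y k ∣ u ∧ x k ∣ v := by
  rw [f_eq hm] at H
  set S := evenGeomSum (x k) (y k) m
  constructor
  · have : y k ∣ u * x k ^ (2 * m + 1) :=
      ⟨-(v * y k ^ (2 * m) + w * (x k * (x k - y k) * (x k + y k)) +
        t * (x k * (x k ^ (2 * m) - x k * (x k - y k) * S))), by linear_combination H⟩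
    exact (prime_y.dvd_or_dvd this).resolve_right
      fun h' => not_y_dvd_x (prime_y.dvd_of_dvd_pow h')
  · have : x k ∣ v * y k ^ (2 * m + 1) :=
      ⟨-(u * x k ^ (2 * m) + w * (y k * (x k - y k) * (x k + y k)) +
        t * (y k * (x k ^ (2 * m) - x k * (x k - y k) * S))), by linear_combination H⟩
    exact (prime_x.dvd_or_dvd this).resolve_right
      fun h' => not_x_dvd_y (prime_x.dvd_of_dvd_pow h')

/-- Cancel xy, substitute x = y and divide by x - y, then substitute x = -y: the surviving relation
has m(u + v) on one side and a multiple of y on the other. -/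
lemma constantCoeff_of_syzygy {m : ℕ} (hm : (m : k) ≠ 0) {u v w t : A k}
    (H : y k * u * x k ^ (2 * m + 1) + x k * v * y k ^ (2 * m + 1) +
      w * (x k * y k * (x k - y k) * (x k + y k)) + t * f k (2 * m + 1) = 0) :
    MvPolynomial.constantCoeff (u + v) = 0 ∧ MvPolynomial.constantCoeff t = 0 := by
  have hm0 : m ≠ 0 := by rintro rfl; simp at hm
  have hx := prime_x (k := k).ne_zero
  have hy := prime_y (k := k).ne_zero
  rw [f_eq hm0] at H
  have hS := evenGeomSum_mul (x k) (y k) m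
  have hS' : setXEqNegY k (evenGeomSum (x k) (y k) m) = evenGeomSum (-y k) (y k) m := by
    simpa using map_evenGeomSum (setXEqNegY k : A k →+* A k) (x k) (y k) m
  have hneg := evenGeomSum_neg (y k) m
  set S := evenGeomSum (x k) (y k) m
  have H1 : u * x k ^ (2 * m) + v * y k ^ (2 * m) + w * ((x k - y k) * (x k + y k)) +
      t * (x k ^ (2 * m) - x k * (x k - y k) * S) = 0 := by
    apply mul_left_cancel₀ (mul_ne_zero hx hy)
    linear_combination H
  obtain ⟨L, hL⟩ := exists_eq_setXEqY_add (u + v + t)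
  have hL0 : setXEqY k (u + v + t) = 0 := by
    apply mul_right_cancel₀ (pow_ne_zero (2 * m) hy)
    have := congrArg (setXEqY k) H1
    simp only [map_add, map_mul, map_sub, map_pow, setXEqY_x, setXEqY_y, map_zero] at this ⊢
    linear_combination this
  rw [hL0, zero_add] at hL
  -- Eliminating t = (x - y)L - u - v makes every term divisible by x - y.
  have H2 : (u * x k - v * y k) * S + L * (x k ^ (2 * m) - x k * (x k - y k) * S) +
      w * (x k + y k) = 0 := by
    apply mul_left_cancel₀ (x_ne_y (k := k))
    linear_combination H1 - (x k ^ (2 * m) - x k * (x k - y k) * S) * hL - v * hS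
  have H3 : (m : A k) * setXEqNegY k (u + v) = y k * ((1 - 2 * m) * setXEqNegY k L) := by
    apply mul_left_cancel₀ (pow_ne_zero (2 * m + 1) hy)
    have := congrArg (setXEqNegY k) H2
    simp only [map_add, map_mul, map_sub, map_pow, setXEqNegY_x, setXEqNegY_y, map_zero,
      hS', (even_two_mul m).neg_pow] at this ⊢
    linear_combination (-y k ^ 2) * this -
      y k * (setXEqNegY k u + setXEqNegY k v + 2 * y k * setXEqNegY k L) * hneg
  have H4 : MvPolynomial.constantCoeff (u + v) = 0 := by
    have := congrArg MvPolynomial.constantCoeff H3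
    rw [map_mul, map_mul, constantCoeff_y, zero_mul, constantCoeff_setXEqNegY, map_natCast] at this
    exact (mul_eq_zero.1 this).resolve_left hm
  refine ⟨H4, ?_⟩
  have := congrArg MvPolynomial.constantCoeff hL
  simpa only [map_add _ (u + v), H4, map_mul, map_sub, constantCoeff_x, constantCoeff_y,
    sub_zero, zero_mul, zero_add] using this

lemma f_notMem_e {m : ℕ} (hm : (m : k) ≠ 0) : f k (2 * m + 1) ∉ e k (2 * m + 1) := by
  have hm0 : m ≠ 0 := by rintro rfl; simp at hm
  intro hf
  obtain ⟨u, v, w, hf⟩ := mem_e_iff.1 hf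
  have H := congrArg (setSZero k) hf
  simp only [map_add, map_mul, map_pow, setSZero_x, setSZero_y, setSZero_g, setSZero_f] at H
  have H' : setSZero k u * x k ^ (2 * m + 1) + setSZero k v * y k ^ (2 * m + 1) +
      setSZero k w * (x k * y k * (x k - y k) * (x k + y k)) + (-1) * f k (2 * m + 1) = 0 := by
    linear_combination -H
  obtain ⟨⟨u', hu⟩, ⟨v', hv⟩⟩ := dvd_of_syzygy hm0 H'
  rw [hu, hv] at H'
  simpa using (constantCoeff_of_syzygy hm H').2

/-! ### Cancelling s. -/

/-- Both monomial generators are multiples of xyⁿ. At s = 0 the coefficient w of g satisfies yⁿ ∣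
w(0)y, so w(0)g is a multiple of yⁿ; the rest of wg is a multiple of sg, and s is prime to y. -/
lemma mem_e_of_s_mul_mem_mixedIdeal {n : ℕ} {q : A k} (hq : s k * q ∈ mixedIdeal k n) :
    q ∈ e k n := by
  obtain ⟨c, w, H⟩ : ∃ c w, s k * q = c * (x k * y k ^ n) + w * g k := by
    simp only [mixedIdeal, Ideal.mem_span_insert, Ideal.mem_span_singleton'] at hq
    obtain ⟨a, _, ⟨b, _, ⟨w, rfl⟩, rfl⟩, hq⟩ := hq
    exact ⟨a * x k + b * y k, w, by rw [hq]; ring⟩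
  have H' := congrArg (setSZero k) H
  simp only [map_add, map_mul, map_pow, setSZero_x, setSZero_y, setSZero_g, setSZero_s] at H'
  have h1 : y k ^ n ∣ setSZero k w * (y k * ((x k - y k) * (x k + y k))) := by
    refine ⟨-setSZero k c, mul_left_cancel₀ (prime_x (k := k)).ne_zero ?_⟩
    linear_combination -H'
  have h2 : ¬ y k ∣ (x k - y k) * (x k + y k) := by
    intro h'
    rcases prime_y.dvd_or_dvd h' with h' | h'
    · exact not_y_dvd_x ((dvd_sub_left dvd_rfl).1 h')
    · exact not_y_dvd_x ((dvd_add_left dvd_rfl).1 h')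
  rw [← mul_assoc] at h1
  obtain ⟨r, hr⟩ := prime_y.pow_dvd_of_dvd_mul_right n h2 h1
  obtain ⟨w', hw'⟩ := exists_eq_setSZero_add w
  have h3 : y k ^ n ∣ s k * (q - w' * g k) := by
    refine ⟨c * x k + r * (x k * (x k - y k) * (x k + y k - s k * y k)), ?_⟩
    rw [g] at *
    linear_combination H + (x k * y k * (x k - y k) * (x k + y k - s k * y k)) * hw' +
      (x k * (x k - y k) * (x k + y k - s k * y k)) * hr
  have h4 : ¬ y k ∣ s k := by
    rw [s, y, MvPolynomial.X_dvd_X]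
    decide
  obtain ⟨r', hr'⟩ := prime_y.pow_dvd_of_dvd_mul_left n h4 h3
  exact mem_e_iff.2 ⟨0, r', w', by linear_combination hr'⟩

lemma s_mul_f_mem_e {m : ℕ} (hm : m ≠ 0) : s k * f k (2 * m + 1) ∈ e k (2 * m + 1) := by
  rw [s_mul_f hm]
  exact mem_e_iff.2 ⟨y k, -(1 - s k) * x k, -evenGeomSum (x k) (y k) m, by ring⟩

lemma e_le_h (n : ℕ) : e k n ≤ h k n := le_sup_left

lemma mem_h_of_s_mul_mem_h {m : ℕ} (hm : (m : k) ≠ 0) {p : A k}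
    (hp : s k * p ∈ h k (2 * m + 1)) : p ∈ h k (2 * m + 1) := by
  have hm0 : m ≠ 0 := by rintro rfl; simp at hm
  obtain ⟨u, v, w, t, hp⟩ := mem_h_iff.1 hp
  have H := congrArg (setSZero k) hp
  simp only [map_add, map_mul, map_pow, setSZero_x, setSZero_y, setSZero_g, setSZero_f,
    setSZero_s, zero_mul] at H
  obtain ⟨⟨u', hu⟩, ⟨v', hv⟩⟩ := dvd_of_syzygy hm0 H.symm
  rw [hu, hv] at H
  obtain ⟨h1, h2⟩ := constantCoeff_of_syzygy hm H.symm
  rw [constantCoeff_setSZero, ← mem_maxIdeal_iff, mem_maxIdeal_iff_exists] at h2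
  rw [← mem_maxIdeal_iff, mem_maxIdeal_iff_exists] at h1
  obtain ⟨a, b, c, h1⟩ := h1
  obtain ⟨a', b', c', h2⟩ := h2
  obtain ⟨u₁, hu₁⟩ := exists_eq_setSZero_add u
  obtain ⟨v₁, hv₁⟩ := exists_eq_setSZero_add v
  rw [hu] at hu₁
  rw [hv] at hv₁
  have hs := s_mul_f (k := k) hm0
  set n := 2 * m + 1
  set S := evenGeomSum (x k) (y k) m
  -- The part of sp visibly divisible by s, using u'xⁿy + v'xyⁿ = (u' + v')xⁿy - v'(xⁿy - xyⁿ) and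
  -- xⁿy - xyⁿ = s(f - xyⁿ) + Sg.
  let q := u₁ * x k ^ n + v₁ * y k ^ n + a' * f k n + a * (x k ^ n * y k) +
    v' * (x k * y k ^ n) - v' * f k n
  have hq : q ∈ h k n :=
    mem_h_iff.2 ⟨u₁ + a * y k, v₁ + v' * x k, 0, a' - v', by simp only [q]; ring⟩
  have key : s k * (p - q) ∈ mixedIdeal k n := by
    have : s k * (p - q) = b * (x k ^ (2 * m + 1 + 1) * y k ^ (0 + 1)) +
        c * (x k ^ (2 * m + 1) * y k ^ (1 + 1)) + (w - v' * S) * g k +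
        b' * (x k * f k n) + c' * (y k * f k n) := by
      simp only [q]
      linear_combination hp + x k ^ n * hu₁ + y k ^ n * hv₁ + f k n * h2 +
        (x k ^ n * y k) * h1 + v' * hs
    rw [this]
    exact add_mem (add_mem (add_mem (add_mem
      (Ideal.mul_mem_left _ _ (monomial_mem_mixedIdeal _ _ _ (by omega)))
      (Ideal.mul_mem_left _ _ (monomial_mem_mixedIdeal _ _ _ (by omega))))
      (Ideal.mul_mem_left _ _ (g_mem_mixedIdeal n)))
      (Ideal.mul_mem_left _ _ (x_mul_f_mem_mixedIdeal n)))
      (Ideal.mul_mem_left _ _ (y_mul_f_mem_mixedIdeal n))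
  have := add_mem (e_le_h n (mem_e_of_s_mul_mem_mixedIdeal key)) hq
  rwa [sub_add_cancel] at this

end ConsExample
-- Local cohomology in degree zero.
namespace localCohomology
open Limits Opposite

instance linearYoneda_preservesLimits {R : Type*} [Ring R] {C : Type*} [Category* C]
    [Preadditive C] [Linear R C] (Y : C) : PreservesLimits ((linearYoneda R C).obj Y) :=
  have : PreservesLimits ((linearYoneda R C).obj Y ⋙ forget (ModuleCat R)) :=
    inferInstanceAs (PreservesLimits (yoneda.obj Y))
  preservesLimits_of_reflects_of_preserves _ (forget (ModuleCat R))

/-- Right exactness lets the zeroth left derived functor defining `Ext` be identified with Hom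
itself. -/
instance linearYoneda_rightOp_preservesFiniteColimits {R : Type*} [Ring R] {C : Type*}
    [Category* C] [Preadditive C] [Linear R C] (Y : C) :
    PreservesFiniteColimits ((linearYoneda R C).obj Y).rightOp :=
  have : PreservesFiniteLimits ((linearYoneda R C).obj Y) := PreservesLimits.preservesFiniteLimits _
  preservesFiniteColimits_rightOp _

variable {R : Type u} [CommRing R]

/-- The functor `Ext⁰(-, Y)` is `Hom(-, Y)`. -/
noncomputable def extZeroFlipIso (Y : ModuleCat.{u} R) :
    (Ext R (ModuleCat.{u} R) 0).flip.obj Y ≅ (linearYoneda R (ModuleCat.{u} R)).obj Y :=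
  NatIso.ofComponents
    (fun _ => ((((linearYoneda R (ModuleCat.{u} R)).obj Y).rightOp.leftDerivedZeroIsoSelf).app
      _).symm.unop)
    (fun φ => Quiver.Hom.op_inj
      ((((linearYoneda R (ModuleCat.{u} R)).obj Y).rightOp.leftDerivedZeroIsoSelf).inv.naturality
        φ.unop).symm)

/-- The direct system `Hom(R / J ^ t, M)`. -/
noncomputable def homDiagram (J : Ideal R) (M : ModuleCat.{u} R) : ℕᵒᵖᵒᵖ ⥤ ModuleCat.{u} R :=
  (ringModIdeals (idealPowersDiagram J)).op ⋙ (linearYoneda R (ModuleCat.{u} R)).obj M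

/-- Degree zero local cohomology is the direct limit of the modules `Hom(R / J ^ t, M)`. -/
noncomputable def zeroIsoColimit (J : Ideal R) (M : ModuleCat.{u} R) :
    (localCohomology J 0).obj M ≅ colimit (homDiagram J M) :=
  have := hasColimitDiagram.{u, 0} (idealPowersDiagram J) 0
  colimitObjIsoColimitCompEvaluation (diagram (idealPowersDiagram J) 0) M ≪≫
    HasColimit.isoOfNatIso (Functor.isoWhiskerLeft (ringModIdeals (idealPowersDiagram J)).op
      (extZeroFlipIso M))

/-- A map R/J^t → M is an element killed by J^t; by `hM` it is already killed by J, so the map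
factors through R/J. -/
lemma homDiagram_isEventuallyConstantFrom (J : Ideal R) (M : ModuleCat.{u} R)
    (hM : ∀ (t : ℕ) (z : M), (∀ r ∈ J ^ t, r • z = 0) → ∀ r ∈ J, r • z = 0) :
    (homDiagram J M).IsEventuallyConstantFrom (op (op 1)) := by
  intro t φ
  rw [ConcreteCategory.isIso_iff_bijective]
  constructor
  · intro a b hab
    refine ModuleCat.hom_ext (LinearMap.ext fun z => ?_)
    obtain ⟨r, rfl⟩ := Submodule.Quotient.mk_surjective _ z
    exact LinearMap.congr_fun (congrArg ModuleCat.Hom.hom hab) (Submodule.Quotient.mk r)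
  · intro (ψ : ModuleCat.of R (R ⧸ J ^ t.unop.unop) ⟶ M)
    let z : M := ψ.hom (Submodule.Quotient.mk 1)
    have hz : ∀ r ∈ J ^ t.unop.unop, r • z = 0 := fun r hr => by
      rw [← map_smul, ← Submodule.Quotient.mk_smul, smul_eq_mul, mul_one,
        (Submodule.Quotient.mk_eq_zero _).2 hr, map_zero]
    have hz' := hM _ z hz
    refine ⟨ModuleCat.ofHom (Submodule.liftQ (J ^ 1) (LinearMap.toSpanSingleton R M z)
      fun r hr => ?_), ?_⟩
    · rw [pow_one] at hr
      exact LinearMap.mem_ker.2 (hz' r hr)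
    · refine ModuleCat.hom_ext (LinearMap.ext fun w => ?_)
      obtain ⟨r, rfl⟩ := Submodule.Quotient.mk_surjective _ w
      change r • z = ψ.hom (Submodule.Quotient.mk r)
      rw [← map_smul, ← Submodule.Quotient.mk_smul, smul_eq_mul, mul_one]

/-- If every `J`-power torsion element of `M` is killed by `J`, and these elements form a cyclic
module generated by `z`, then `H⁰_J(M) ≅ R / ann(z)`. -/
lemma nonempty_zero_iso (J I : Ideal R) (M : ModuleCat.{u} R) (z : M)
    (hM : ∀ (t : ℕ) (w : M), (∀ r ∈ J ^ t, r • w = 0) → ∃ a : R, w = a • z)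
    (hz : ∀ r ∈ J, r • z = 0) (hI : ∀ r, r • z = 0 ↔ r ∈ I) :
    Nonempty ((localCohomology J 0).obj M ≅ ModuleCat.of R (R ⧸ I)) := by
  have hc := homDiagram_isEventuallyConstantFrom J M fun t w hw r hr => by
    obtain ⟨a, rfl⟩ := hM t w hw
    rw [smul_comm, hz r hr, smul_zero]
  have := hc.isIso_ι_of_isColimit (colimit.isColimit (homDiagram J M))
  let ζ : ModuleCat.of R (R ⧸ J ^ 1) ⟶ M :=
    ModuleCat.ofHom (Submodule.liftQ (J ^ 1) (LinearMap.toSpanSingleton R M z)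
      fun r hr => LinearMap.mem_ker.2 (hz r (by rwa [pow_one] at hr)))
  have hζ (r : R) : ζ.hom (Submodule.Quotient.mk r) = r • z := rfl
  -- Every map R/J → M is a multiple of the one sending 1 to z, so Hom(R/J, M) ≅ R/ker θ with ker θ
  -- = ann(z).
  let θ : R →ₗ[R] (ModuleCat.of R (R ⧸ J ^ 1) ⟶ M) := LinearMap.toSpanSingleton R _ ζ
  have hθ (a r : R) : (θ a).hom (Submodule.Quotient.mk r) = a • r • z := rfl
  have hsurj : Function.Surjective θ := fun ψ => by
    obtain ⟨a, ha⟩ := hM 1 (ψ.hom (Submodule.Quotient.mk 1)) fun r hr => by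
      rw [← map_smul, ← Submodule.Quotient.mk_smul, smul_eq_mul, mul_one,
        (Submodule.Quotient.mk_eq_zero _).2 hr, map_zero]
    refine ⟨a, ModuleCat.hom_ext (LinearMap.ext fun w => ?_)⟩
    obtain ⟨r, rfl⟩ := Submodule.Quotient.mk_surjective _ w
    rw [hθ, smul_comm, ← ha, ← map_smul, ← Submodule.Quotient.mk_smul, smul_eq_mul, mul_one]
  have hker : LinearMap.ker θ = I := by
    ext r
    rw [LinearMap.mem_ker, ← hI]
    constructor
    · intro h
      have := hθ r 1
      rw [h, one_smul] at this
      exact this.symm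
    · intro h
      refine ModuleCat.hom_ext (LinearMap.ext fun w => ?_)
      obtain ⟨r', rfl⟩ := Submodule.Quotient.mk_surjective _ w
      rw [hθ, smul_comm, h, smul_zero]
      rfl
  let iso₁ : ModuleCat.of R (R ⧸ I) ≅ (homDiagram J M).obj (op (op 1)) :=
    ((Submodule.quotEquivOfEq _ _ hker.symm).trans
      (θ.quotKerEquivOfSurjective hsurj)).toModuleIso
  exact ⟨zeroIsoColimit J M ≪≫
    (asIso ((colimit.cocone (homDiagram J M)).ι.app (op (op 1)))).symm ≪≫ iso₁.symm⟩

end localCohomology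
-- Colon ideals, saturations and H⁰ of A/e.
namespace ConsExample
variable {k : Type u} [Field k]

lemma x_mul_f_mem_e (n : ℕ) : x k * f k n ∈ e k n := mixedIdeal_le_e n (x_mul_f_mem_mixedIdeal n)

lemma y_mul_f_mem_e (n : ℕ) : y k * f k n ∈ e k n := mixedIdeal_le_e n (y_mul_f_mem_mixedIdeal n)

lemma maxIdeal_le_colon_f {m : ℕ} (hm : m ≠ 0) :
    maxIdeal k ≤ (e k (2 * m + 1)).colon {f k (2 * m + 1)} := by
  rw [maxIdeal, Ideal.span_le]
  rintro _ (rfl | rfl | rfl) <;>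
    rw [SetLike.mem_coe, Submodule.mem_colon_singleton, smul_eq_mul]
  exacts [s_mul_f_mem_e hm, x_mul_f_mem_e _, y_mul_f_mem_e _]

lemma maxIdeal_isMaximal : (maxIdeal k).IsMaximal := by
  have : maxIdeal k = RingHom.ker (MvPolynomial.constantCoeff (σ := Fin 3) (R := k)) := by
    ext p
    rw [mem_maxIdeal_iff, RingHom.mem_ker]
  rw [this]
  exact RingHom.ker_isMaximal_of_surjective _
    fun a => ⟨MvPolynomial.C a, MvPolynomial.constantCoeff_C _ a⟩

lemma colon_f_eq {m : ℕ} (hm : (m : k) ≠ 0) :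
    (e k (2 * m + 1)).colon {f k (2 * m + 1)} = maxIdeal k := by
  have hm0 : m ≠ 0 := by rintro rfl; simp at hm
  refine (maxIdeal_isMaximal.eq_of_le (fun h => f_notMem_e hm ?_) (maxIdeal_le_colon_f hm0)).symm
  have := (Ideal.eq_top_iff_one _).1 h
  rwa [Submodule.mem_colon_singleton, one_smul] at this

lemma h_le_colon_s {m : ℕ} (hm : m ≠ 0) :
    h k (2 * m + 1) ≤ (e k (2 * m + 1)).colon {s k} := by
  rw [h, sup_le_iff]
  constructor
  · refine fun p (hp : p ∈ e k (2 * m + 1)) => Submodule.mem_colon_singleton.2 ?_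
    rw [smul_eq_mul, mul_comm p (s k)]
    exact Ideal.mul_mem_left _ (s k) hp
  · rw [Ideal.span_singleton_le_iff_mem, Submodule.mem_colon_singleton, smul_eq_mul,
      mul_comm _ (s k)]
    exact s_mul_f_mem_e hm

lemma mem_h_of_mul_s_pow_mem {m : ℕ} (hm : (m : k) ≠ 0) {p : A k} (N : ℕ)
    (hp : p * s k ^ N ∈ h k (2 * m + 1)) : p ∈ h k (2 * m + 1) := by
  induction N with
  | zero => simpa using hp
  | succ N ih => exact ih (mem_h_of_s_mul_mem_h hm (by
      rwa [pow_succ, ← mul_assoc, mul_comm _ (s k)] at hp))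

lemma colon_s_h {m : ℕ} (hm : (m : k) ≠ 0) :
    (h k (2 * m + 1)).colon {s k} = h k (2 * m + 1) := by
  ext p
  rw [Submodule.mem_colon_singleton, smul_eq_mul]
  exact ⟨fun hp => mem_h_of_s_mul_mem_h hm (by rwa [mul_comm (s k) p]), Ideal.mul_mem_right _ _⟩

lemma saturation_anti {R : Type*} [CommRing R] (I : Ideal R) {J K : Ideal R} (hJK : J ≤ K) :
    saturation I K ≤ saturation I J :=
  fun _ ⟨N, hN⟩ => ⟨N, fun b hb => hN b (Ideal.pow_right_mono hJK N hb)⟩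

lemma h_le_saturation_maxIdeal {m : ℕ} (hm : m ≠ 0) :
    h k (2 * m + 1) ≤ saturation (e k (2 * m + 1)) (maxIdeal k) := by
  rw [h, sup_le_iff, Ideal.span_singleton_le_iff_mem]
  refine ⟨fun p hp => ⟨0, fun b _ => mul_comm b p ▸ Ideal.mul_mem_left _ b hp⟩, 1, fun b hb => ?_⟩
  rw [pow_one] at hb
  rw [mul_comm (f k _) b]
  exact Submodule.mem_colon_singleton.1 (maxIdeal_le_colon_f hm hb)

lemma saturation_s_le_h {m : ℕ} (hm : (m : k) ≠ 0) :
    saturation (e k (2 * m + 1)) (Ideal.span {s k}) ≤ h k (2 * m + 1) :=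
  fun _ ⟨N, hN⟩ => mem_h_of_mul_s_pow_mem hm N (e_le_h _
    (hN _ (Ideal.pow_mem_pow (Ideal.mem_span_singleton_self _) N)))

lemma span_s_le_maxIdeal : Ideal.span {s k} ≤ maxIdeal k :=
  Ideal.span_mono (by simp)

lemma localCohomology_zero_quotient_e {m : ℕ} (hm : (m : k) ≠ 0) :
    Nonempty ((localCohomology (maxIdeal k) 0).obj
      (ModuleCat.of (A k) (A k ⧸ e k (2 * m + 1))) ≅ ModuleCat.of (A k) (A k ⧸ maxIdeal k)) := by
  have hm0 : m ≠ 0 := by rintro rfl; simp at hm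
  have hI (r : A k) : r • (Submodule.Quotient.mk (f k (2 * m + 1)) : A k ⧸ e k (2 * m + 1)) = 0 ↔
      r ∈ maxIdeal k := by
    rw [← Submodule.Quotient.mk_smul, Submodule.Quotient.mk_eq_zero, ← colon_f_eq hm,
      Submodule.mem_colon_singleton]
  refine localCohomology.nonempty_zero_iso _ _ _
    (Submodule.Quotient.mk (f k (2 * m + 1)) : A k ⧸ e k (2 * m + 1))
    (fun t w hw => ?_) (fun r hr => (hI r).2 hr) hI
  obtain ⟨p, rfl⟩ := Submodule.Quotient.mk_surjective _ w
  have hp : p ∈ h k (2 * m + 1) := by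
    refine saturation_s_le_h hm (saturation_anti _ span_s_le_maxIdeal ⟨t, fun b hb => ?_⟩)
    have := hw b hb
    rwa [← Submodule.Quotient.mk_smul, Submodule.Quotient.mk_eq_zero, smul_eq_mul,
      mul_comm b p] at this
  -- Modulo e, an element of h is a multiple of f.
  obtain ⟨q, hq, _, hr, rfl⟩ := Submodule.mem_sup.1 hp
  obtain ⟨a, rfl⟩ := Ideal.mem_span_singleton'.1 hr
  refine ⟨a, ?_⟩
  rw [← Submodule.Quotient.mk_smul, Submodule.Quotient.eq, smul_eq_mul, add_sub_cancel_right]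
  exact hq

end ConsExample

theorem mainTheorem9 (k : Type u) [Field k] (m n : ℕ) (hm : 4 ≤ m)
    (hchar : ¬ ringChar k ∣ m) (hn : n = 2 * m + 1) :
    -- (1)
    Ideal.span {x k, y k} ^ (n + 2) ≤ e k n ∧
    -- (2)
    (s k * f k n ∈ e k n ∧ h k n ≤ (e k n).colon {s k}) ∧
    -- (3)
    (x k * f k n ∈ e k n ∧ y k * f k n ∈ e k n ∧ maxIdeal k ≤ (e k n).colon {f k n}) ∧
    -- (4)
    (f k n ∉ e k n ∧ (e k n).colon {f k n} ≠ ⊤ ∧ (e k n).colon {f k n} = maxIdeal k) ∧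
    -- (5)
    (h k n).colon {s k} = h k n ∧
    -- (6)
    (saturation (e k n) (maxIdeal k) = saturation (e k n) (Ideal.span {s k}) ∧
      saturation (e k n) (Ideal.span {s k}) = h k n) ∧
    -- (7): an isomorphism of `A`-modules
    Nonempty ((localCohomology (maxIdeal k) 0).obj (ModuleCat.of (A k) (A k ⧸ e k n)) ≅
      ModuleCat.of (A k) (A k ⧸ maxIdeal k)) := by
  subst hn
  have hmk : (m : k) ≠ 0 := fun h0 => hchar ((ringChar.spec k m).1 h0)
  have hm0 : m ≠ 0 := by omega
  refine ⟨span_xy_pow_le _, ⟨s_mul_f_mem_e hm0, h_le_colon_s hm0⟩,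
    ⟨x_mul_f_mem_e _, y_mul_f_mem_e _, maxIdeal_le_colon_f hm0⟩,
    ⟨f_notMem_e hmk, ?_, colon_f_eq hmk⟩, colon_s_h hmk, ⟨?_, ?_⟩,
    localCohomology_zero_quotient_e hmk⟩
  · rw [colon_f_eq hmk]
    exact maxIdeal_isMaximal.ne_top
  · exact le_antisymm (saturation_anti _ span_s_le_maxIdeal)
      ((saturation_s_le_h hmk).trans (h_le_saturation_maxIdeal hm0))
  · exact le_antisymm (saturation_s_le_h hmk)
      ((h_le_saturation_maxIdeal hm0).trans (saturation_anti _ span_s_le_maxIdeal))
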